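/- A subgroup $H$ of a group $G$ is a \emph{virtual retract} of $G$ if there are a subgroup $K\leqslant G$ of finite index with $H\subseteq K$ and a homomorphism $\rho:K\to H$ that restricts to the identity on $H$. The group $G$ has property (LR) if every finitely generated subgroup of $G$ is a virtual retract of $G$. For groups $A$ and $B$, the restricted wreath product $A\wr B$ is the semidirect product $A^{B}\rtimes B$, where $A^{B}$ is the group of all finitely supported functions $f:B\to A$ under pointwise multiplication and $b\in B$ acts by $(bfb^{-1})(x)=f(xb)$ for all $x\in B$. \textbf{Theorem.} Let $A$ be a finitely generated abelian group. Then $A\wr\mathbb{Z}$ has property (LR) if and only if $A$ is semisimple, i.e. $A$ is a direct sum of (possibly no) cyclic groups of prime order. -/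

import Mathlib

/-- `H` is a virtual retract of `G`: some finite index subgroup `K` of `G` contains `H` and
admits a homomorphism onto `H` restricting to the identity on `H`. -/
def IsVirtualRetract {G : Type*} [Group G] (H : Subgroup G) : Prop :=
  ∃ (K : Subgroup G) (hHK : H ≤ K), K.FiniteIndex ∧
    ∃ ρ : K →* H, ∀ h : H, ρ (Subgroup.inclusion hHK h) = h

/-- Property (LR): all finitely generated subgroups are virtual retracts. -/
def HasLR (G : Type*) [Group G] : Prop :=
  ∀ H : Subgroup G, H.FG → IsVirtualRetract H

/-- The group of finitely supported functions `B → A` under pointwise multiplication. -/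
def finSuppFun (A B : Type*) [Group A] : Subgroup (B → A) where
  carrier := {f | (Function.mulSupport f).Finite}
  one_mem' := by simp
  mul_mem' := fun {f g} hf hg =>
    (Set.Finite.union hf hg).subset (Function.mulSupport_mul f g)
  inv_mem' := fun {f} hf => by
    simpa [Function.mulSupport_inv] using hf

/-- The action of `B` on finitely supported functions: `(b • f) x = f (x * b)`. -/
def finSuppShift (A B : Type*) [Group A] [Group B] : B →* MulAut (finSuppFun A B) where
  toFun b :=
    { toFun := fun f => ⟨fun x => f.1 (x * b),
        Set.Finite.preimage (mul_left_injective b).injOn f.2⟩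
      invFun := fun f => ⟨fun x => f.1 (x * b⁻¹),
        Set.Finite.preimage (mul_left_injective b⁻¹).injOn f.2⟩
      left_inv := fun f => by ext x; simp
      right_inv := fun f => by ext x; simp
      map_mul' := fun f g => rfl }
  map_one' := by ext f x; simp
  map_mul' b c := by ext f x; simp [mul_assoc]

/-- The restricted wreath product of `A` and `B`. -/
abbrev RestrictedWreathProduct (A B : Type*) [Group A] [Group B] :=
  finSuppFun A B ⋊[finSuppShift A B] B

/-- A (multiplicatively written) abelian group is semisimple if it is a direct sum of
cyclic groups of prime order. -/
def IsSemisimpleAbelian.{u} (A : Type u) [CommGroup A] : Prop :=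
  ∃ (ι : Type u) (p : ι → ℕ), (∀ i, (p i).Prime) ∧
    Nonempty (Additive A ≃+ DirectSum ι fun i => ZMod (p i))

/-! Suppose `A` is semisimple, hence finite. Let `H` have nontrivial image in `ℤ`, generated by `z`,
and let `N` be its intersection with the base. Zorn yields a `z`-invariant pseudocomplement `C` of
`N` in the base. The base is generated by finitely many `z`-orbits of elements of prime order, and
there an essential invariant subgroup has finite index (`finiteIndex_of_essential`). So `N ⊔ C`, and
hence `H ⊔ C`, has finite index, and killing `C` retracts onto `H`. If the image of `H` is trivial,
`H` is finite and residual finiteness supplies a normal complement.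

Conversely, a virtual retraction onto the subgroup generated by `ℤ` and one copy of `a ^ p` makes `a
^ p` a `p ^ 2`-th power (`exists_pow_sq_eq_pow_of_hasLR`). When this holds for all primes, the
structure theorem leaves no infinite cyclic summand and none of order `p ^ e` with `e ≥ 2`. -/

/-! ### Criteria for virtual retracts and finite index -/

open scoped Pointwise in
theorem isVirtualRetract_of_normalized_complement {G : Type*} [Group G] {H C : Subgroup G}
    (hn : ∀ h ∈ H, ∀ c ∈ C, h * c * h⁻¹ ∈ C) (hd : Disjoint H C) (hf : (H ⊔ C).FiniteIndex) :
    IsVirtualRetract H := by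
  have hHC : H ≤ Subgroup.normalizer (C : Set G) := by
    intro h hh
    rw [Subgroup.mem_normalizer_iff]
    refine fun c => ⟨fun hc => hn h hh c hc, fun hc => ?_⟩
    have := hn h⁻¹ (H.inv_mem hh) _ hc
    simpa [mul_assoc] using this
  have hK : H ⊔ C ≤ Subgroup.normalizer (C : Set G) := sup_le hHC Subgroup.le_normalizer
  have hN : (C.subgroupOf (H ⊔ C)).Normal := Subgroup.normal_subgroupOf_of_le_normalizer hK
  -- The retraction is the quotient by `C` followed by the inverse of this isomorphism.
  let φ : H →* (↥(H ⊔ C)) ⧸ C.subgroupOf (H ⊔ C) :=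
    (QuotientGroup.mk' _).comp (Subgroup.inclusion le_sup_left)
  have hφ : Function.Bijective φ := by
    constructor
    · rw [injective_iff_map_eq_one]
      intro h hh
      have hC : (h : G) ∈ C := by
        have := (QuotientGroup.eq_one_iff (N := C.subgroupOf (H ⊔ C))
          (Subgroup.inclusion le_sup_left h)).1 hh
        simpa [Subgroup.mem_subgroupOf] using this
      exact Subtype.ext (Subgroup.disjoint_def.1 hd h.2 hC)
    · intro q
      obtain ⟨⟨k, hk⟩, rfl⟩ := QuotientGroup.mk_surjective q
      have hk' : k ∈ (H : Set G) * (C : Set G) := by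
        rw [← Subgroup.coe_mul_of_left_le_normalizer_right H C hHC]
        exact hk
      obtain ⟨h, hh, c, hc, rfl⟩ := hk'
      refine ⟨⟨h, hh⟩, ?_⟩
      refine (QuotientGroup.eq (s := C.subgroupOf (H ⊔ C))).2 ?_
      simpa [Subgroup.mem_subgroupOf] using hc
  refine ⟨H ⊔ C, le_sup_left, hf,
    (MulEquiv.ofBijective φ hφ).symm.toMonoidHom.comp (QuotientGroup.mk' _), fun h => ?_⟩
  exact (MulEquiv.ofBijective φ hφ).symm_apply_apply h

theorem Subgroup.finiteIndex_of_map_of_relIndex_ker {G Q : Type*} [Group G] [Group Q] (φ : G →* Q)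
    (hφ : Function.Surjective φ) (K : Subgroup G) (h₁ : (K.map φ).FiniteIndex)
    (h₂ : (K.subgroupOf φ.ker).FiniteIndex) : K.FiniteIndex := by
  have := Subgroup.finite_quotient_of_finiteIndex (H := K.map φ)
  have := Subgroup.finite_quotient_of_finiteIndex (H := K.subgroupOf φ.ker)
  choose r hr using hφ
  let F : (Q ⧸ K.map φ) × (φ.ker ⧸ K.subgroupOf φ.ker) → G ⧸ K :=
    fun x => ((r x.1.out * (x.2.out : G) : G) : G ⧸ K)
  have hF : Function.Surjective F := by
    intro y
    obtain ⟨g, rfl⟩ := QuotientGroup.mk_surjective y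
    have h := QuotientGroup.eq.1 (QuotientGroup.out_eq' (φ g : Q ⧸ K.map φ))
    obtain ⟨k, hk, hk'⟩ := h
    have hb : (r (φ g : Q ⧸ K.map φ).out)⁻¹ * g * k⁻¹ ∈ φ.ker := by
      simp [MonoidHom.mem_ker, hr, hk', mul_assoc]
    have h := QuotientGroup.eq.1
      (QuotientGroup.out_eq' ((⟨_, hb⟩ : φ.ker) : φ.ker ⧸ K.subgroupOf φ.ker))
    refine ⟨((φ g : Q ⧸ K.map φ), ((⟨_, hb⟩ : φ.ker) : φ.ker ⧸ K.subgroupOf φ.ker)), ?_⟩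
    refine QuotientGroup.eq.2 ?_
    have h' := K.mul_mem (Subgroup.mem_subgroupOf.1 h) hk
    simpa [mul_assoc] using h'
  have := Finite.of_surjective F hF
  exact Subgroup.finiteIndex_of_finite_quotient

/-! ### Invariant subgroups of an abelian group with an automorphism -/

theorem mem_of_zpow_mem_of_prime_pow_eq_one {M : Type*} [Group M] {W : Subgroup M} {x : M} {p : ℕ}
    (hp : p.Prime) (hx : x ^ p = 1) {c : ℤ} (hc : ¬ (p : ℤ) ∣ c) (h : x ^ c ∈ W) : x ∈ W := by
  obtain ⟨u, v, huv⟩ := ((Nat.prime_iff_prime_int.1 hp).coprime_iff_not_dvd).2 hc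
  have : x = (x ^ c) ^ v := by
    calc x = x ^ (u * p + v * c) := by rw [huv, zpow_one]
      _ = (x ^ c) ^ v := by
        rw [zpow_add, mul_comm u, zpow_mul, zpow_natCast, hx, one_zpow, one_mul, mul_comm v,
          zpow_mul]
  rw [this]
  exact W.zpow_mem h v

/-- An invariant subgroup has an invariant pseudocomplement: a disjoint invariant subgroup such
that the join of the two meets every nontrivial invariant subgroup. -/
theorem exists_invariant_pseudocomplement {M : Type*} [CommGroup M] (σ : MulAut M) (N : Subgroup M) :
    ∃ C : Subgroup M, C.map σ.toMonoidHom = C ∧ Disjoint N C ∧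
      ∀ U : Subgroup M, U.map σ.toMonoidHom = U → Disjoint U (N ⊔ C) → U = ⊥ := by
  obtain ⟨C, hC⟩ := zorn_le₀ {C : Subgroup M | C.map σ.toMonoidHom = C ∧ Disjoint N C} (by
    intro c hc hchain
    rcases c.eq_empty_or_nonempty with rfl | hne
    · exact ⟨⊥, ⟨by simp, disjoint_bot_right⟩, by simp⟩
    refine ⟨sSup c, ⟨?_, ?_⟩, fun _ h => le_sSup h⟩
    · rw [sSup_eq_iSup, Subgroup.map_iSup]
      refine iSup_congr fun D => ?_
      rw [Subgroup.map_iSup]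
      exact iSup_congr fun hD => (hc hD).1
    · rw [Subgroup.disjoint_def]
      intro x hxN hx
      obtain ⟨D, hD, hxD⟩ := (Subgroup.mem_sSup_of_directedOn hne hchain.directedOn).1 hx
      exact Subgroup.disjoint_def.1 (hc hD).2 hxN hxD)
  refine ⟨C, hC.prop.1, hC.prop.2, fun U hU hd => ?_⟩
  have hle : C ⊔ U ≤ C := by
    refine hC.le_of_ge ⟨by rw [Subgroup.map_sup, hC.prop.1, hU], ?_⟩ le_sup_left
    rw [Subgroup.disjoint_def]
    intro x hxN hx
    obtain ⟨c, hc, u, hu, rfl⟩ := Subgroup.mem_sup.1 hx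
    have hu' : u ∈ N ⊔ C := by
      have := mul_mem ((le_sup_right : C ≤ N ⊔ C) (inv_mem hc)) ((le_sup_left : N ≤ N ⊔ C) hxN)
      simpa using this
    have hu1 : u = 1 := Subgroup.disjoint_def.1 hd hu hu'
    subst hu1
    rw [mul_one] at hxN ⊢
    exact Subgroup.disjoint_def.1 hC.prop.2 hxN hc
  have hUC : U ≤ N ⊔ C := le_sup_right.trans (hle.trans le_sup_right)
  exact disjoint_self.1 (hd.mono_right hUC)

/-- The orbit of `x` spans a cyclic module over the Laurent polynomials over `𝔽_p`. If it meets `E`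
nontrivially, one nonzero relation modulo `E`, with extreme coefficients invertible mod `p`,
expresses every translate through a finite window. -/
theorem exists_finite_orbit_subset_sup_closure {M : Type*} [CommGroup M] (σ : MulAut M)
    (E : Subgroup M) (hE : E.map σ.toMonoidHom = E)
    (hess : ∀ U : Subgroup M, U.map σ.toMonoidHom = U → Disjoint U E → U = ⊥)
    {x : M} {p : ℕ} (hp : p.Prime) (hx : x ^ p = 1) :
    ∃ T : Set M, T.Finite ∧ ∀ k : ℤ, (σ ^ k) x ∈ E ⊔ Subgroup.closure T := by
  set y : ℤ → M := fun k => (σ ^ k) x with hy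
  have hσy : ∀ k, σ (y k) = y (k + 1) := fun k => by
    simp only [hy, add_comm k 1, zpow_add, zpow_one, MulAut.mul_apply]
  have hyp : ∀ k, y k ^ p = 1 := fun k => by simp only [hy, ← map_pow, hx, map_one]
  have hEσ : ∀ {m}, σ m ∈ E ↔ m ∈ E := by
    intro m
    constructor
    · intro h
      rw [← hE] at h
      obtain ⟨m', hm', h⟩ := h
      rwa [← σ.injective h]
    · intro h
      rw [← hE]
      exact ⟨m, h, rfl⟩
  set U := Subgroup.closure (Set.range y) with hUdef
  have hU : U.map σ.toMonoidHom = U := by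
    rw [hUdef, MonoidHom.map_closure, ← Set.range_comp]
    congr 1
    ext m
    constructor
    · rintro ⟨k, rfl⟩
      exact ⟨k + 1, (hσy k).symm⟩
    · rintro ⟨k, rfl⟩
      exact ⟨k - 1, by simpa using hσy (k - 1)⟩
  by_cases hd : Disjoint U E
  · refine ⟨∅, Set.finite_empty, fun k => ?_⟩
    have : y k ∈ U := Subgroup.subset_closure ⟨k, rfl⟩
    rw [hess U hU hd, Subgroup.mem_bot] at this
    change y k ∈ _
    rw [this]
    exact one_mem _
  obtain ⟨f, hfU, hfE, hf1⟩ : ∃ f ∈ U, f ∈ E ∧ f ≠ 1 := by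
    by_contra! h
    exact hd (Subgroup.disjoint_def.2 fun hu he => h _ hu he)
  obtain ⟨c, rfl⟩ := Subgroup.exists_finsupp_of_mem_closure_range y f hfU
  classical
  -- Exponents divisible by `p` contribute nothing; the remaining ones are invertible mod `p`, so
  -- the relation can be solved for any single term.
  set S := c.support.filter fun k => ¬ (p : ℤ) ∣ c k with hS
  have hprod : (c.prod fun k n => y k ^ n) = ∏ k ∈ S, y k ^ c k := by
    rw [Finsupp.prod, hS]
    refine (Finset.prod_filter_of_ne (p := fun k => ¬ (p : ℤ) ∣ c k)
      fun k _ hk hdvd => hk ?_).symm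
    obtain ⟨d, hd⟩ := hdvd
    rw [hd, zpow_mul, zpow_natCast, hyp, one_zpow]
  rw [hprod] at hfE hf1
  have hSne : S.Nonempty := by
    by_contra h
    rw [Finset.not_nonempty_iff_eq_empty] at h
    exact hf1 (by rw [h, Finset.prod_empty])
  set a := S.min' hSne with ha
  set b := S.max' hSne with hb
  have hSp : ∀ k ∈ S, ¬ (p : ℤ) ∣ c k := fun k hk => (Finset.mem_filter.1 hk).2
  have key : ∀ (V : Subgroup M) (j : ℤ), j ∈ S → E ≤ V → (∀ k ∈ S, k ≠ j → y k ∈ V) → y j ∈ V := by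
    intro V j hj hEV hV
    refine mem_of_zpow_mem_of_prime_pow_eq_one hp (hyp j) (hSp j hj) ?_
    have h1 : ∏ k ∈ S.erase j, y k ^ c k ∈ V := prod_mem fun k hk =>
      zpow_mem (hV k (Finset.mem_of_mem_erase hk) (Finset.ne_of_mem_erase hk)) _
    have h2 := hEV hfE
    rw [← Finset.mul_prod_erase S _ hj] at h2
    exact (Subgroup.mul_mem_cancel_right V h1).1 h2
  -- The window omits `b`: solving for `y b` makes `W` stable under `σ`, and solving for `y a` makes
  -- it stable under `σ⁻¹`.
  set W := E ⊔ Subgroup.closure (y '' Set.Ico a b) with hW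
  have hyW : ∀ k, a ≤ k → k < b → y k ∈ W := fun k h1 h2 =>
    (le_sup_right : _ ≤ W) (Subgroup.subset_closure ⟨k, ⟨h1, h2⟩, rfl⟩)
  have hbW : y b ∈ W := key W b (S.max'_mem hSne) le_sup_left fun k hk hkb =>
    hyW k (S.min'_le k hk) (lt_of_le_of_ne (S.le_max' k hk) hkb)
  have hup : W ≤ W.comap σ.toMonoidHom := by
    refine sup_le (fun m hm => (le_sup_left : E ≤ W) (hEσ.2 hm)) ?_
    rw [Subgroup.closure_le]
    rintro _ ⟨k, ⟨h1, h2⟩, rfl⟩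
    change σ (y k) ∈ W
    rw [hσy]
    rcases (Int.add_one_le_of_lt h2).lt_or_eq with h | h
    · exact hyW _ (by omega) h
    · rw [h]
      exact hbW
  have hdown : W ≤ W.map σ.toMonoidHom := by
    have hmem : ∀ k, a < k → k ≤ b → y k ∈ W.map σ.toMonoidHom := fun k h1 h2 =>
      ⟨y (k - 1), hyW _ (by omega) (by omega), by simpa using hσy (k - 1)⟩
    have hEm : E ≤ W.map σ.toMonoidHom := by
      conv_lhs => rw [← hE]
      exact Subgroup.map_mono le_sup_left
    have haW : y a ∈ W.map σ.toMonoidHom := key _ a (S.min'_mem hSne) hEm fun k hk hka =>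
      hmem k (lt_of_le_of_ne (S.min'_le k hk) (Ne.symm hka)) (S.le_max' k hk)
    refine sup_le hEm ?_
    rw [Subgroup.closure_le]
    rintro _ ⟨k, ⟨h1, h2⟩, rfl⟩
    rcases h1.eq_or_lt with h | h
    · rw [← h]
      exact haW
    · exact hmem k h h2.le
  refine ⟨y '' Set.Ico a b, (Set.finite_Ico a b).image y, fun k => ?_⟩
  change y k ∈ W
  induction k using Int.inductionOn' (b := b) with
  | zero => exact hbW
  | succ k _ ih => rw [← hσy]; exact hup ih
  | pred k _ ih =>
    obtain ⟨m, hm, h⟩ := hdown ih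
    have : m = y (k - 1) := σ.injective (by rw [hσy, sub_add_cancel]; exact h)
    rwa [← this]

/-- Modulo `E` each of the finitely many orbits lies in a finitely generated subgroup, so the
quotient is finitely generated, abelian and torsion, hence finite. -/
theorem finiteIndex_of_essential {M : Type*} [CommGroup M] (σ : MulAut M)
    (E : Subgroup M) (hE : E.map σ.toMonoidHom = E)
    (hess : ∀ U : Subgroup M, U.map σ.toMonoidHom = U → Disjoint U E → U = ⊥)
    (htors : IsMulTorsion M)
    (X : Set M) (hXfin : X.Finite) (hX : ∀ x ∈ X, ∃ p : ℕ, p.Prime ∧ x ^ p = 1)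
    (hgen : Subgroup.closure {m | ∃ x ∈ X, ∃ k : ℤ, (σ ^ k) x = m} = ⊤) :
    E.FiniteIndex := by
  have h : ∀ x : X, ∃ T : Set M, T.Finite ∧ ∀ k : ℤ, (σ ^ k) x.1 ∈ E ⊔ Subgroup.closure T :=
    fun x => by
      obtain ⟨p, hp, hxp⟩ := hX x.1 x.2
      exact exists_finite_orbit_subset_sup_closure σ E hE hess hp hxp
  choose T hTfin hT using h
  have := hXfin.to_subtype
  have hfin : (⋃ x, T x).Finite := Set.finite_iUnion hTfin
  have htop : E ⊔ Subgroup.closure (⋃ x, T x) = ⊤ := by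
    rw [eq_top_iff, ← hgen, Subgroup.closure_le]
    rintro _ ⟨x, hx, k, rfl⟩
    exact sup_le_sup_left (Subgroup.closure_mono (Set.subset_iUnion T ⟨x, hx⟩)) E (hT ⟨x, hx⟩ k)
  have hq : Subgroup.closure ((QuotientGroup.mk' E) '' ⋃ x, T x) = ⊤ := by
    rw [← MonoidHom.map_closure, ← Subgroup.map_top_of_surjective (QuotientGroup.mk' E)
      (QuotientGroup.mk'_surjective E), ← htop, Subgroup.map_sup]
    have : E.map (QuotientGroup.mk' E) = ⊥ := by
      rw [Subgroup.map_eq_bot_iff, QuotientGroup.ker_mk']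
    rw [this, bot_sup_eq]
  have hfg : Group.FG (M ⧸ E) := Group.fg_iff.2 ⟨_, hq, hfin.image _⟩
  have := CommGroup.finite_of_fg_isMulTorsion (M ⧸ E)
    (IsMulTorsion.of_surjective (QuotientGroup.mk'_surjective E) htors)
  exact Subgroup.finiteIndex_of_finite_quotient

/-! ### The base group and its shift -/

/-- The inclusion of the copy of `A` at the position `b`. -/
def finSuppSingle (A : Type*) {B : Type*} [Group A] [DecidableEq B] (b : B) :
    A →* finSuppFun A B :=
  (MonoidHom.mulSingle (fun _ : B => A) b).codRestrict (finSuppFun A B) fun _ =>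
    (Set.finite_singleton b).subset Pi.mulSupport_mulSingle_subset

theorem finSuppSingle_coe {A B : Type*} [Group A] [DecidableEq B] (b : B) (a : A) :
    (finSuppSingle A b a : B → A) = Pi.mulSingle b a := rfl

theorem finSuppShift_single {A B : Type*} [Group A] [Group B] [DecidableEq B] (c b : B) (a : A) :
    finSuppShift A B c (finSuppSingle A b a) = finSuppSingle A (b * c⁻¹) a := by
  ext x
  change Pi.mulSingle (M := fun _ : B => A) b a (x * c) =
    Pi.mulSingle (M := fun _ : B => A) (b * c⁻¹) a x
  simp only [Pi.mulSingle_apply, eq_mul_inv_iff_mul_eq]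

theorem finSuppFun_eq_top_of_single_mem {A B : Type*} [CommGroup A] [DecidableEq B]
    (K : Subgroup (finSuppFun A B)) (h : ∀ b a, finSuppSingle A b a ∈ K) : K = ⊤ := by
  rw [eq_top_iff]
  rintro f -
  have : f = ∏ b ∈ f.2.toFinset, finSuppSingle A b (f.1 b) := by
    ext x
    rw [Subgroup.val_finsetProd, Finset.prod_apply]
    simp only [finSuppSingle_coe, Pi.mulSingle_apply]
    rw [Finset.prod_ite_eq]
    split_ifs with hx
    · rfl
    · by_contra h
      exact hx (f.2.mem_toFinset.2 h)
  rw [this]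
  exact prod_mem fun b _ => h _ _

theorem conj_inl {M B : Type*} [CommGroup M] [Group B] {φ : B →* MulAut M} (g : M ⋊[φ] B) (m : M) :
    g * SemidirectProduct.inl m * g⁻¹ = SemidirectProduct.inl (φ g.right m) := by
  ext <;> simp [mul_comm, mul_left_comm]

theorem finSuppFun_isMulTorsion (A B : Type*) [CommGroup A] [Finite A] :
    IsMulTorsion (finSuppFun A B) := fun f => by
  refine isOfFinOrder_iff_pow_eq_one.2 ⟨Nat.card A, Nat.card_pos, ?_⟩
  ext x
  simp

theorem Subgroup.map_mulAut_eq_of_forall_mem {M : Type*} [Group M] (σ : MulAut M) (N : Subgroup M)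
    (h₁ : ∀ m ∈ N, σ m ∈ N) (h₂ : ∀ m ∈ N, σ⁻¹ m ∈ N) : N.map σ.toMonoidHom = N := by
  refine le_antisymm ?_ fun m hm => ⟨σ⁻¹ m, h₂ m hm, by simp⟩
  rintro _ ⟨m, hm, rfl⟩
  exact h₁ m hm

theorem zpow_mem_of_map_eq {M : Type*} [Group M] {σ : MulAut M} {C : Subgroup M}
    (hC : C.map σ.toMonoidHom = C) (k : ℤ) {m : M} (hm : m ∈ C) : (σ ^ k) m ∈ C := by
  induction k with
  | zero => simpa using hm
  | succ k ih =>
    rw [add_comm, zpow_add, zpow_one, MulAut.mul_apply, ← hC]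
    exact ⟨_, ih, rfl⟩
  | pred k ih =>
    rw [sub_eq_add_neg, add_comm, zpow_add, zpow_neg_one, MulAut.mul_apply]
    rw [← hC] at ih
    obtain ⟨m', hm', h⟩ := ih
    rw [← h]
    simpa using hm'

theorem finSuppFun_closure_orbits {A : Type*} [CommGroup A]
    (hA : Subgroup.closure {a : A | ∃ p : ℕ, p.Prime ∧ a ^ p = 1} = ⊤) {n : ℤ} (hn : n ≠ 0) :
    Subgroup.closure {m | ∃ x ∈ Set.image2 (fun (r : ℤ) (a : A) =>
        finSuppSingle A (Multiplicative.ofAdd r) a) (Set.Ico 0 |n|)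
          {a : A | ∃ p : ℕ, p.Prime ∧ a ^ p = 1},
      ∃ k : ℤ, (finSuppShift A (Multiplicative ℤ) (Multiplicative.ofAdd n) ^ k) x = m} = ⊤ := by
  refine finSuppFun_eq_top_of_single_mem _ fun b a => ?_
  suffices h : Subgroup.closure {a : A | ∃ p : ℕ, p.Prime ∧ a ^ p = 1} ≤
      (Subgroup.closure _).comap (finSuppSingle A b) by
    rw [hA] at h
    exact h (Subgroup.mem_top a)
  rw [Subgroup.closure_le]
  intro a ha
  -- Division with remainder by `n`: the remainder selects the orbit and the quotient the translate.
  refine Subgroup.subset_closure ⟨_, ⟨b.toAdd % n, ⟨Int.emod_nonneg _ hn, Int.emod_lt_abs _ hn⟩,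
    a, ha, rfl⟩, -(b.toAdd / n), ?_⟩
  rw [← map_zpow, finSuppShift_single]
  have hb : Multiplicative.ofAdd (b.toAdd % n) *
      (Multiplicative.ofAdd n ^ (-(b.toAdd / n)))⁻¹ = b := by
    apply Multiplicative.toAdd.injective
    simp only [toAdd_mul, toAdd_ofAdd, toAdd_inv, toAdd_zpow, smul_eq_mul]
    linarith [Int.emod_add_mul_ediv b.toAdd n, mul_comm n (b.toAdd / n)]
  rw [hb]

theorem Int.finiteIndex_zpowers_multiplicative {z : Multiplicative ℤ} (hz : z ≠ 1) :
    (Subgroup.zpowers z).FiniteIndex := by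
  rw [Subgroup.finiteIndex_iff]
  have : (Subgroup.zpowers z).index = (AddSubgroup.zmultiples z.toAdd).index := rfl
  rw [this, Int.index_zmultiples]
  simpa using hz

/-! ### Subgroups with nontrivial image in `ℤ` -/

theorem isVirtualRetract_of_map_rightHom_ne_bot {A : Type*} [CommGroup A] [Finite A]
    (hA : Subgroup.closure {a : A | ∃ p : ℕ, p.Prime ∧ a ^ p = 1} = ⊤)
    (H : Subgroup (RestrictedWreathProduct A (Multiplicative ℤ)))
    (hH : H.map SemidirectProduct.rightHom ≠ ⊥) : IsVirtualRetract H := by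
  obtain ⟨z, hz⟩ := (Subgroup.isCyclic_iff_exists_zpowers_eq_top
    (H.map SemidirectProduct.rightHom)).1 inferInstance
  have hz1 : z ≠ 1 := by
    rintro rfl
    exact hH (by rw [← hz, Subgroup.zpowers_one_eq_bot])
  obtain ⟨g, hgH, hg⟩ : z ∈ H.map SemidirectProduct.rightHom := hz ▸ Subgroup.mem_zpowers z
  replace hg : g.right = z := hg
  set σ : MulAut (finSuppFun A (Multiplicative ℤ)) := finSuppShift A (Multiplicative ℤ) z with hσ
  set N := H.comap (SemidirectProduct.inl : _ →* RestrictedWreathProduct A (Multiplicative ℤ))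
    with hNdef
  have hN : N.map σ.toMonoidHom = N := by
    refine Subgroup.map_mulAut_eq_of_forall_mem σ N (fun m hm => ?_) fun m hm => ?_
    · have := H.mul_mem (H.mul_mem hgH hm) (H.inv_mem hgH)
      rw [conj_inl, hg] at this
      exact this
    · have := H.mul_mem (H.mul_mem (H.inv_mem hgH) hm) (H.inv_mem (H.inv_mem hgH))
      rw [conj_inl, SemidirectProduct.inv_right, hg, map_inv] at this
      exact this
  obtain ⟨C, hC, hdisj, hess⟩ := exists_invariant_pseudocomplement σ N
  have hfin : (N ⊔ C).FiniteIndex := by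
    refine finiteIndex_of_essential σ (N ⊔ C) (by rw [Subgroup.map_sup, hN, hC]) hess
      (finSuppFun_isMulTorsion A _) _ ((Set.finite_Ico _ _).image2 _ (Set.toFinite _)) ?_
      (finSuppFun_closure_orbits hA (n := z.toAdd) (by simpa using hz1))
    rintro _ ⟨r, -, a, ⟨p, hp, ha⟩, rfl⟩
    exact ⟨p, hp, by simp only [← map_pow, ha, map_one]⟩
  refine isVirtualRetract_of_normalized_complement (C := C.map SemidirectProduct.inl) ?_ ?_ ?_
  -- As the base is abelian, `h` acts on it only through `h.right`, a power of `z`, which preserves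
  -- `C`.
  · rintro h hh _ ⟨c, hc, rfl⟩
    obtain ⟨k, hk⟩ : h.right ∈ Subgroup.zpowers z := hz ▸ ⟨h, hh, rfl⟩
    rw [conj_inl, ← hk]
    refine ⟨_, ?_, rfl⟩
    simp only [map_zpow]
    exact zpow_mem_of_map_eq hC k hc
  · rw [Subgroup.disjoint_def]
    rintro _ hH ⟨c, hc, rfl⟩
    rw [Subgroup.disjoint_def.1 hdisj hH hc, map_one]
  · refine Subgroup.finiteIndex_of_map_of_relIndex_ker SemidirectProduct.rightHom
      SemidirectProduct.rightHom_surjective _ ?_ ?_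
    · have := Int.finiteIndex_zpowers_multiplicative hz1
      exact Subgroup.finiteIndex_of_le (H := Subgroup.zpowers z)
        (hz.le.trans (Subgroup.map_mono le_sup_left))
    · rw [← Subgroup.isFiniteRelIndex_iff_finiteIndex,
        Subgroup.isFiniteRelIndex_iff_relIndex_ne_zero,
        ← SemidirectProduct.range_inl_eq_ker_rightHom, ← Subgroup.index_comap]
      refine (Subgroup.finiteIndex_of_le (H := N ⊔ C) (sup_le ?_ ?_)).index_ne_zero
      · exact Subgroup.comap_mono le_sup_left
      · exact Subgroup.map_le_iff_le_comap.1 le_sup_right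

/-! ### Subgroups of the base and residual finiteness -/

theorem isVirtualRetract_of_finite {G : Type*} [Group G] (H : Subgroup G) [Finite H]
    (hres : ∀ h ∈ H, h ≠ 1 → ∃ F : Subgroup G, F.Normal ∧ F.FiniteIndex ∧ h ∉ F) :
    IsVirtualRetract H := by
  have h : ∀ h : H, ∃ F : Subgroup G, F.Normal ∧ F.FiniteIndex ∧ ((h : G) ≠ 1 → (h : G) ∉ F) := by
    intro h
    by_cases h1 : (h : G) = 1
    · exact ⟨⊤, inferInstance, inferInstance, fun h' => absurd h1 h'⟩
    · obtain ⟨F, hF⟩ := hres h h.2 h1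
      exact ⟨F, hF.1, hF.2.1, fun _ => hF.2.2⟩
  choose F hF hFi hFh using h
  have hfi : (⨅ h, F h).FiniteIndex := Subgroup.finiteIndex_iInf hFi
  have hn : (⨅ h, F h).Normal := Subgroup.normal_iInf_normal hF
  refine isVirtualRetract_of_normalized_complement (C := ⨅ h, F h)
    (fun h _ c hc => hn.conj_mem c hc h) ?_ (Subgroup.finiteIndex_of_le le_sup_right)
  rw [Subgroup.disjoint_def]
  intro x hx hxF
  by_contra h1
  exact hFh ⟨x, hx⟩ h1 (Subgroup.mem_iInf.1 hxF ⟨x, hx⟩)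

/-- Multiplication along the fibres of a map. -/
noncomputable def finSuppPush (A : Type*) {B B' : Type*} [CommGroup A] [Finite B'] (π : B → B') :
    finSuppFun A B →* finSuppFun A B' where
  toFun f := ⟨fun y => ∏ᶠ (x) (_ : π x = y), f.1 x, Set.toFinite _⟩
  map_one' := by
    ext y
    simp
  map_mul' f g := by
    ext y
    exact finprod_mem_mul_distrib' (s := {x | π x = y}) (f.2.subset Set.inter_subset_right)
      (g.2.subset Set.inter_subset_right)

theorem finSuppPush_apply {A B B' : Type*} [CommGroup A] [Finite B'] (π : B → B')
    (f : finSuppFun A B) (y : B') :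
    (finSuppPush A π f).1 y = ∏ᶠ (x) (_ : π x = y), f.1 x := rfl

theorem finSuppPush_shift {A B B' : Type*} [CommGroup A] [Group B] [Group B'] [Finite B']
    (π : B →* B') (b : B) (f : finSuppFun A B) :
    finSuppPush A π (finSuppShift A B b f) = finSuppShift A B' (π b) (finSuppPush A π f) := by
  ext y
  change ∏ᶠ (x) (_ : π x = y), f.1 (x * b) = ∏ᶠ (x) (_ : π x = y * π b), f.1 x
  rw [← finprod_comp_equiv (Equiv.mulRight b) (f := fun x => ∏ᶠ (_ : π x = y * π b), f.1 x)]
  simp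

/-- The homomorphism of wreath products with an abelian base induced by a homomorphism of the
acting groups. -/
noncomputable def wreathPush (A : Type*) {B B' : Type*} [CommGroup A] [Group B] [Group B']
    [Finite B'] (π : B →* B') : RestrictedWreathProduct A B →* RestrictedWreathProduct A B' :=
  SemidirectProduct.map (finSuppPush A π) π fun b => by
    ext1 f
    exact finSuppPush_shift π b f

theorem exists_finiteIndex_notMem {A : Type*} [CommGroup A] [Finite A]
    (f : finSuppFun A (Multiplicative ℤ)) (hf : f ≠ 1) :
    ∃ F : Subgroup (RestrictedWreathProduct A (Multiplicative ℤ)),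
      F.Normal ∧ F.FiniteIndex ∧ SemidirectProduct.inl f ∉ F := by
  obtain ⟨x, hx⟩ : ∃ x, f.1 x ≠ 1 := by
    by_contra! h
    exact hf (Subtype.ext (funext h))
  -- `N` bounds the distance from `x` to the support, so modulo `N + 1` no other support point
  -- collides with `x`, and the push-forward keeps the value `f x`.
  obtain ⟨N, hN⟩ := (f.2.image fun y => (y.toAdd - x.toAdd).natAbs).bddAbove
  let π : Multiplicative ℤ →* Multiplicative (ZMod (N + 1)) :=
    (Int.castAddHom (ZMod (N + 1))).toMultiplicative
  have : Finite (RestrictedWreathProduct A (Multiplicative (ZMod (N + 1)))) :=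
    Finite.of_equiv _ SemidirectProduct.equivProd.symm
  refine ⟨(wreathPush A π).ker, inferInstance, inferInstance, fun h => hx ?_⟩
  rw [MonoidHom.mem_ker, wreathPush, SemidirectProduct.map_inl, ← map_one SemidirectProduct.inl,
    SemidirectProduct.inl_inj] at h
  have h' : (finSuppPush A π f).1 (π x) = 1 := by rw [h]; rfl
  rw [finSuppPush_apply, finprod_eq_single _ x, finprod_eq_if, if_pos rfl] at h'
  · exact h'
  intro y hy
  rw [finprod_eq_if]
  split_ifs with hπ
  · by_contra hfy
    have hle : (y.toAdd - x.toAdd).natAbs ≤ N := hN ⟨y, hfy, rfl⟩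
    have hdvd : ((N + 1 : ℕ) : ℤ) ∣ y.toAdd - x.toAdd :=
      (ZMod.intCast_eq_intCast_iff_dvd_sub _ _ _).1 (Eq.symm hπ)
    have h0 := Int.eq_zero_of_dvd_of_natAbs_lt_natAbs hdvd (by omega)
    exact hy (Multiplicative.toAdd.injective (by omega))
  · rfl

theorem isVirtualRetract_of_map_rightHom_eq_bot {A : Type*} [CommGroup A] [Finite A]
    (H : Subgroup (RestrictedWreathProduct A (Multiplicative ℤ))) (hfg : H.FG)
    (hH : H.map SemidirectProduct.rightHom = ⊥) : IsVirtualRetract H := by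
  have hr : ∀ h ∈ H, h = SemidirectProduct.inl h.left := fun h hh => by
    have h1 : h.right ∈ H.map SemidirectProduct.rightHom := ⟨h, hh, rfl⟩
    rw [hH, Subgroup.mem_bot] at h1
    ext1
    · rfl
    · exact h1
  have hfin : Finite H := by
    let _ : CommGroup H :=
      { mul_comm := fun x y => Subtype.ext (by
          change (x : RestrictedWreathProduct A (Multiplicative ℤ)) * y = y * x
          rw [hr x x.2, hr y y.2, ← map_mul, ← map_mul, mul_comm]) }
    have : Group.FG H := (Group.fg_iff_subgroup_fg H).2 hfg
    refine CommGroup.finite_of_fg_isMulTorsion H fun h => ?_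
    refine (Submonoid.isOfFinOrder_coe (H := H.toSubmonoid) (x := h)).1 ?_
    rw [hr h h.2]
    exact (SemidirectProduct.inl (φ := finSuppShift A (Multiplicative ℤ))).isOfFinOrder
      (finSuppFun_isMulTorsion A _ _)
  refine isVirtualRetract_of_finite H fun h hh h1 => ?_
  rw [hr h hh] at h1 ⊢
  exact exists_finiteIndex_notMem _ fun h' => h1 (by rw [h', map_one])

/-! ### Semisimple groups give (LR) -/

theorem IsSemisimpleAbelian.closure_prime_order {A : Type*} [CommGroup A]
    (h : IsSemisimpleAbelian A) :
    Subgroup.closure {a : A | ∃ p : ℕ, p.Prime ∧ a ^ p = 1} = ⊤ := by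
  obtain ⟨ι, p, hp, ⟨e⟩⟩ := h
  classical
  rw [eq_top_iff]
  rintro a -
  have key : ∀ x : DirectSum ι fun i => ZMod (p i), (e.symm x).toMul ∈
      Subgroup.closure {a : A | ∃ p : ℕ, p.Prime ∧ a ^ p = 1} := by
    intro x
    induction x using DirectSum.induction_on with
    | zero => rw [map_zero]; exact one_mem _
    | of i x =>
      refine Subgroup.subset_closure ⟨p i, hp i, ?_⟩
      rw [← toMul_nsmul, ← map_nsmul, ← map_nsmul, nsmul_eq_mul, CharP.cast_eq_zero, zero_mul,
        map_zero, map_zero]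
      rfl
    | add x y hx hy => rw [map_add, toMul_add]; exact mul_mem hx hy
  simpa using key (e (Additive.ofMul a))

theorem IsSemisimpleAbelian.finite {A : Type*} [CommGroup A] [Group.FG A]
    (h : IsSemisimpleAbelian A) : Finite A := by
  refine CommGroup.finite_of_fg_isMulTorsion A fun a => ?_
  have hle : Subgroup.closure {a : A | ∃ p : ℕ, p.Prime ∧ a ^ p = 1} ≤ CommGroup.torsion A := by
    rw [Subgroup.closure_le]
    rintro a ⟨p, hp, ha⟩
    exact isOfFinOrder_iff_pow_eq_one.2 ⟨p, hp.pos, ha⟩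
  rw [h.closure_prime_order] at hle
  exact hle (Subgroup.mem_top a)

theorem IsSemisimpleAbelian.hasLR {A : Type*} [CommGroup A] [Group.FG A]
    (h : IsSemisimpleAbelian A) : HasLR (RestrictedWreathProduct A (Multiplicative ℤ)) := by
  intro H hfg
  have := h.finite
  by_cases hH : H.map SemidirectProduct.rightHom = ⊥
  · exact isVirtualRetract_of_map_rightHom_eq_bot H hfg hH
  · exact isVirtualRetract_of_map_rightHom_ne_bot h.closure_prime_order H hH

/-! ### (LR) forces semisimplicity -/

/-- The elements of the wreath product all of whose base coordinates lie in `P`. -/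
def coordinatesIn {A B : Type*} [Group A] [Group B] (P : Subgroup A) :
    Subgroup (RestrictedWreathProduct A B) where
  carrier := {g | ∀ x, g.left.1 x ∈ P}
  one_mem' := fun _ => P.one_mem
  mul_mem' := fun {g _} hg hh x => P.mul_mem (hg x) (hh (x * g.right))
  inv_mem' := fun {g} hg x => P.inv_mem (hg (x * g.right⁻¹))

/-- Elements of `H` have all base coordinates in the `p`-th powers. A retraction fixes the `p`-th
power of a suitable element of `K`, so the image of that element is a `p`-th root inside `H`. -/
theorem exists_pow_sq_eq_pow_of_hasLR {A : Type*} [CommGroup A]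
    (hLR : HasLR (RestrictedWreathProduct A (Multiplicative ℤ))) {p : ℕ} (hp : p ≠ 0) (a : A) :
    ∃ b : A, b ^ (p * p) = a ^ p := by
  let δ : Multiplicative ℤ → A →*
      RestrictedWreathProduct A (Multiplicative ℤ) := fun x => SemidirectProduct.inl.comp (finSuppSingle A x)
  let t : Multiplicative ℤ →* RestrictedWreathProduct A (Multiplicative ℤ) := SemidirectProduct.inr
  let H : Subgroup (RestrictedWreathProduct A (Multiplicative ℤ)) :=
    Subgroup.closure {t (Multiplicative.ofAdd 1), δ 1 (a ^ p)}
  have hHP : H ≤ coordinatesIn (powMonoidHom p).range := by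
    rw [Subgroup.closure_le]
    rintro _ (rfl | rfl) x
    · exact one_mem _
    · change (Pi.mulSingle 1 (a ^ p) : Multiplicative ℤ → A) x ∈ _
      rw [Pi.mulSingle_apply]
      split_ifs
      · exact ⟨a, rfl⟩
      · exact one_mem _
  have ht : ∀ x, t x ∈ H := fun x => by
    have h1 : t (Multiplicative.ofAdd 1) ∈ H := Subgroup.subset_closure (Or.inl rfl)
    have := H.zpow_mem h1 x.toAdd
    rwa [← map_zpow, ← ofAdd_zsmul, smul_eq_mul, mul_one, ofAdd_toAdd] at this
  have hδ : ∀ x, δ x (a ^ p) ∈ H := fun x => by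
    have h1 : δ 1 (a ^ p) ∈ H := Subgroup.subset_closure (Or.inr rfl)
    have h2 := H.mul_mem (H.mul_mem (ht x⁻¹) h1) (H.inv_mem (ht x⁻¹))
    have h3 : t x⁻¹ * δ 1 (a ^ p) * (t x⁻¹)⁻¹ = δ x (a ^ p) := by
      change SemidirectProduct.inr x⁻¹ * SemidirectProduct.inl _ * (SemidirectProduct.inr x⁻¹)⁻¹ = _
      rw [conj_inl, SemidirectProduct.right_inr, finSuppShift_single, one_mul, inv_inv]
      rfl
    rwa [h3] at h2
  obtain ⟨K, hHK, hK, ρ, hρ⟩ := hLR H ((Subgroup.fg_iff _).2 ⟨_, rfl, Set.toFinite _⟩)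
  have : Finite (RestrictedWreathProduct A (Multiplicative ℤ) ⧸ K) := Subgroup.finite_quotient_of_finiteIndex
  -- Pigeonhole: infinitely many positions, finitely many cosets of `K`.
  obtain ⟨x, y, hxy, hq⟩ :=
    Finite.exists_ne_map_eq_of_infinite fun x => (δ x a : RestrictedWreathProduct A (Multiplicative ℤ) ⧸ K)
  have hk : (δ x a)⁻¹ * δ y a ∈ K := QuotientGroup.eq.1 hq
  have hpow : ((δ x a)⁻¹ * δ y a) ^ p = (δ x (a ^ p))⁻¹ * δ y (a ^ p) := by
    have hc : Commute (δ x a) (δ y a) :=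
      (Commute.all (finSuppSingle A x a) (finSuppSingle A y a)).map SemidirectProduct.inl
    rw [hc.inv_left.mul_pow, inv_pow, map_pow, map_pow]
  have hmem : ((δ x a)⁻¹ * δ y a) ^ p ∈ H := by
    rw [hpow]
    exact H.mul_mem (H.inv_mem (hδ x)) (hδ y)
  set r : RestrictedWreathProduct A (Multiplicative ℤ) :=
    (ρ ⟨_, hk⟩ : H).1 with hr
  have hrp : r ^ p = ((δ x a)⁻¹ * δ y a) ^ p := by
    rw [hr, ← SubgroupClass.coe_pow, ← map_pow]
    exact congrArg Subtype.val (hρ ⟨_, hmem⟩)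
  have hrP : r ∈ coordinatesIn (powMonoidHom p).range := hHP (ρ ⟨_, hk⟩).2
  have hright : r.right = 1 := by
    have h := congrArg SemidirectProduct.rightHom hrp
    rw [map_pow, map_pow, map_mul, map_inv] at h
    simp only [δ, MonoidHom.comp_apply, SemidirectProduct.rightHom_inl, inv_one, one_mul,
      one_pow] at h
    -- `ℤ` is torsion-free, so the root `r` lies in the base and can be compared coordinatewise.
    exact (pow_eq_one_iff_left hp).1 h
  have hrl : r = SemidirectProduct.inl r.left := by
    ext1
    · rfl
    · exact hright
  rw [hrl, hpow] at hrp
  simp only [δ, MonoidHom.comp_apply, ← map_inv, ← map_mul, ← map_pow,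
    SemidirectProduct.inl_inj] at hrp
  have hy := congrFun (congrArg Subtype.val hrp) y
  obtain ⟨b, hb⟩ := hrP y
  refine ⟨b, ?_⟩
  change (r.left.1 y) ^ p = (Pi.mulSingle x (a ^ p)⁻¹ : Multiplicative ℤ → A) y *
    (Pi.mulSingle y (a ^ p) : Multiplicative ℤ → A) y at hy
  rw [Pi.mulSingle_eq_same, Pi.mulSingle_eq_of_ne hxy.symm, one_mul, ← hb] at hy
  rw [pow_mul]
  exact hy

theorem isSemisimpleAbelian_of_forall_pow {A : Type*} [CommGroup A] [Group.FG A]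
    (h : ∀ p : ℕ, p.Prime → ∀ a : A, ∃ b : A, b ^ (p * p) = a ^ p) : IsSemisimpleAbelian A := by
  obtain ⟨n, ι, _, p, hp, e, ⟨φ⟩⟩ := AddCommGroup.equiv_free_prod_directSum_zmod (Additive A)
  have hsurj : ∀ {B : Type} [AddCommGroup B]
      (f : ((Fin n →₀ ℤ) × DirectSum ι fun i => ZMod (p i ^ e i)) →+ B),
      Function.Surjective f → ∀ q : ℕ, q.Prime → ∀ b : B, ∃ c : B, (q * q) • c = q • b := by
    intro B _ f hf q hq b
    obtain ⟨x, rfl⟩ := hf b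
    obtain ⟨y, hy⟩ := h q hq (φ.symm x).toMul
    refine ⟨f (φ (Additive.ofMul y)), ?_⟩
    rw [← map_nsmul, ← map_nsmul, ← ofMul_pow, hy, ofMul_pow, ofMul_toMul, map_nsmul, map_nsmul,
      AddEquiv.apply_symm_apply]
  classical
  have hn : IsEmpty (Fin n) := by
    refine ⟨fun i => ?_⟩
    -- In `ℤ` with `q = 2` and element `1` this would read `4 * c = 2`.
    obtain ⟨c, hc⟩ := hsurj ((Finsupp.applyAddHom i).comp (AddMonoidHom.fst _ _))
      (fun z => ⟨(Finsupp.single i z, 0), by simp⟩) 2 Nat.prime_two 1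
    simp only [nsmul_eq_mul, Nat.cast_mul, Nat.cast_ofNat] at hc
    omega
  have he : ∀ i, e i ≤ 1 := by
    intro i
    by_contra! hi
    obtain ⟨c, hc⟩ := hsurj ((DFinsupp.evalAddMonoidHom i).comp (AddMonoidHom.snd _ _))
      (fun z => ⟨(0, DirectSum.of (fun i => ZMod (p i ^ e i)) i z), by
        exact DirectSum.of_eq_same (β := fun i => ZMod (p i ^ e i)) i z⟩) (p i) (hp i) 1
    obtain ⟨c, rfl⟩ := ZMod.intCast_surjective c
    have hdvd : ((p i ^ e i : ℕ) : ℤ) ∣ p i - p i * p i * c := by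
      rw [← ZMod.intCast_eq_intCast_iff_dvd_sub]
      simpa [nsmul_eq_mul] using hc
    have h2 : (p i : ℤ) * p i ∣ p i * (1 - p i * c) := by
      refine dvd_trans ?_ (hdvd.trans (dvd_of_eq (by ring)))
      rw [← sq, Nat.cast_pow]
      exact pow_dvd_pow _ hi
    have hp0 : (p i : ℤ) ≠ 0 := by exact_mod_cast (hp i).ne_zero
    have h3 := Int.dvd_of_mul_dvd_mul_left hp0 h2
    have h4 : (p i : ℤ) ∣ 1 := (dvd_sub_left (dvd_mul_right _ _)).1 h3
    exact (Nat.prime_iff_prime_int.1 (hp i)).not_dvd_one h4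
  -- Exponents `0` give trivial summands, which are discarded; `ULift` places the index type in the
  -- universe of `A`.
  have heq : ∀ j : ULift {i // e i ≠ 0}, p j.down ^ e j.down = p j.down := fun j => by
    rw [show e j.down = 1 from le_antisymm (he _) (Nat.one_le_iff_ne_zero.2 j.down.2), pow_one]
  let ψ : ((Fin n →₀ ℤ) × DirectSum ι fun i => ZMod (p i ^ e i)) →+
      (∀ j : ULift {i // e i ≠ 0}, ZMod (p j.down)) :=
    { toFun := fun x j => ZMod.ringEquivCongr (heq j) (x.2 j.down)
      map_zero' := by ext j; simp
      map_add' := fun x y => by ext j; simp }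
  have hψ : Function.Bijective ψ := by
    constructor
    · rintro ⟨x₁, x₂⟩ ⟨y₁, y₂⟩ hxy
      refine Prod.ext (Subsingleton.elim _ _) (DFinsupp.ext fun i => ?_)
      by_cases hi : e i = 0
      · have : Subsingleton (ZMod (p i ^ e i)) := by
          rw [hi, pow_zero]
          infer_instance
        exact Subsingleton.elim _ _
      · exact (ZMod.ringEquivCongr (heq ⟨⟨i, hi⟩⟩)).injective (congrFun hxy ⟨⟨i, hi⟩⟩)
    · intro y
      refine ⟨(0, DirectSum.mk (fun i => ZMod (p i ^ e i)) Finset.univ fun i =>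
        if hi : e i = 0 then 0 else (ZMod.ringEquivCongr (heq ⟨⟨i, hi⟩⟩)).symm (y ⟨⟨i, hi⟩⟩)), ?_⟩
      ext j
      change ZMod.ringEquivCongr (heq j) (DirectSum.mk (fun i => ZMod (p i ^ e i)) _ _ j.down.1) = _
      rw [DirectSum.mk_apply_of_mem (Finset.mem_univ _), dif_neg j.down.2]
      exact RingEquiv.apply_symm_apply _ _
  exact ⟨ULift {i // e i ≠ 0}, fun j => p j.down, fun j => hp _,
    ⟨(φ.trans (AddEquiv.ofBijective ψ hψ)).trans (DirectSum.addEquivProd _).symm⟩⟩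

theorem mainTheorem9 (A : Type*) [CommGroup A] [Group.FG A] :
    HasLR (RestrictedWreathProduct A (Multiplicative ℤ)) ↔ IsSemisimpleAbelian A :=
  ⟨fun h => isSemisimpleAbelian_of_forall_pow fun _ hp =>
      exists_pow_sq_eq_pow_of_hasLR h hp.ne_zero,
    IsSemisimpleAbelian.hasLR⟩
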